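/- All groups are finite and all characters are complex. Let $\pi$ be a set of primes, let $\pi'$ be the complementary set of primes, and call a positive integer a $\pi$-number if all of its prime divisors lie in $\pi$. A group $G$ is $\pi$-separable if it has a normal series each of whose factors is a $\pi$-group or a $\pi'$-group. A character $\chi\in\mathrm{Irr}(G)$ is \emph{$\pi$-special} if $\chi(1)$ is a $\pi$-number and, for every subnormal subgroup $S$ of $G$, every irreducible constituent of $\chi_S$ has determinantal order a $\pi$-number. It is \emph{$\pi$-factored} if $\chi=\alpha\beta$ with $\alpha$ $\pi$-special and $\beta$ $\pi'$-special. A \emph{$\pi$-factored subnormal pair} for $\chi\in\mathrm{Irr}(G)$ is a pair $(S,\sigma)$ where $S$ is subnormal in $G$ and $\sigma$ is a $\pi$-factored irreducible constituent of $\chi_S$; such pairs are ordered by $(S,\sigma)\le(T,\tau)$ if $S\le T$ and $\sigma$ is a constituent of $\tau_S$. A \emph{$\pi$-nucleus} of $\chi\in\mathrm{Irr}(G)$ is defined recursively: if $\chi$ is $\pi$-factored, it is $(G,\chi)$; otherwise take a maximal $\pi$-factored subnormal pair $(S,\sigma)$ for $\chi$, let $T$ be the stabilizer of $(S,\sigma)$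 in $G$, and let $\tau\in\mathrm{Irr}(T)$ lie over $\sigma$ with $\tau^G=\chi$; every $\pi$-nucleus of $\tau$ is then a $\pi$-nucleus of $\chi$. (For $\pi$-separable $G$, a $\pi$-nucleus exists and is unique up to conjugacy in $G$.) Let $\mathrm{B}_\pi(G)$ be the set of all $\chi\in\mathrm{Irr}(G)$ that have a $\pi$-nucleus $(X,\eta)$ with $\eta$ $\pi$-special. \textbf{Theorem.} Let $\pi$ be a set of primes, $G$ a finite $\pi$-separable group and $N$ a normal subgroup of $G$. Identify $\mathrm{Irr}(G/N)$ with a subset of $\mathrm{Irr}(G)$ by inflation. Then $$\mathrm{B}_\pi(G/N)=\mathrm{Irr}(G/N)\cap\mathrm{B}_\pi(G).$$ -/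

import Mathlib

universe u

noncomputable section

namespace BPi

/-- `n` is a `π`-number: a positive integer all of whose prime divisors lie in `π`. The set `π'` of
the remaining primes is `πᶜ`. -/
def IsPiNumber (π : Set Nat.Primes) (n : ℕ) : Prop :=
  n ≠ 0 ∧ ∀ p : Nat.Primes, (p : ℕ) ∣ n → p ∈ π

/-- `G` is `π`-separable: it has a finite normal series each of whose factors is a `π`-group or a
`π'`-group. -/
def IsPiSeparable (π : Set Nat.Primes) (G : Type*) [Group G] : Prop :=
  ∃ (n : ℕ) (H : ℕ → Subgroup G), H 0 = ⊥ ∧ H n = ⊤ ∧ (∀ i ≤ n, (H i).Normal) ∧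
    ∀ i < n, H i ≤ H (i + 1) ∧
      (IsPiNumber π ((H i).relIndex (H (i + 1))) ∨ IsPiNumber πᶜ ((H i).relIndex (H (i + 1))))

/-- `χ` is the character of a finite-dimensional complex representation of `G`; the zero function
is included, as the character of the zero representation. -/
def IsChar {G : Type*} [Group G] (χ : G → ℂ) : Prop :=
  ∃ (n : ℕ) (ρ : Representation ℂ G (Fin n → ℂ)), ρ.character = χ

/-- `Irr(G)`, the set of irreducible complex characters of `G`. -/
def Irr (G : Type*) [Group G] : Set (G → ℂ) :=
  {χ | ∃ (n : ℕ) (ρ : Representation ℂ G (Fin n → ℂ)), ρ.IsIrreducible ∧ ρ.character = χ}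

/-- The restriction of a function on `G` to a subgroup `S`. -/
def res {G : Type*} [Group G] (S : Subgroup G) (χ : G → ℂ) : S → ℂ := fun s => χ s

/-- `ψ` is an irreducible constituent of the character `χ`: `ψ` is irreducible, and `χ - ψ` is a
character or zero. -/
def IsIrrConstituent {G : Type*} [Group G] (ψ χ : G → ℂ) : Prop :=
  ψ ∈ Irr G ∧ ∃ θ : G → ℂ, IsChar θ ∧ χ = ψ + θ

/-- The determinantal order of the character `ψ` is a `π`-number, i.e. the order of the linear
character `det ρ` is, where `ρ` affords `ψ` (`det ρ` depends only on `ψ`). -/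
def HasPiDetOrder {G : Type*} [Group G] (π : Set Nat.Primes) (ψ : G → ℂ) : Prop :=
  ∃ (n : ℕ) (ρ : Representation ℂ G (Fin n → ℂ)), ρ.character = ψ ∧
    IsPiNumber π (orderOf ((LinearMap.det : Module.End ℂ (Fin n → ℂ) →* ℂ).comp ρ))

/-- `χ` is a `π`-special character of `G`. -/
def IsPiSpecial {G : Type*} [Group G] (π : Set Nat.Primes) (χ : G → ℂ) : Prop :=
  χ ∈ Irr G ∧ (∃ n : ℕ, χ 1 = n ∧ IsPiNumber π n) ∧
    ∀ S : Subgroup G, S.IsSubnormal →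
      ∀ ψ : S → ℂ, IsIrrConstituent ψ (res S χ) → HasPiDetOrder π ψ

/-- `χ` is a `π`-factored character of `G`: an irreducible character that is the product of a
`π`-special and a `π'`-special one. -/
def IsPiFactored {G : Type*} [Group G] (π : Set Nat.Primes) (χ : G → ℂ) : Prop :=
  χ ∈ Irr G ∧ ∃ α β : G → ℂ, IsPiSpecial π α ∧ IsPiSpecial πᶜ β ∧ χ = α * β

/-- A pair `(S, σ)` of a subgroup `S` of `G` and a complex function `σ` on `S`. -/
structure CharPair (G : Type u) [Group G] where
  /-- the subgroup -/
  S : Subgroup G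
  /-- the function on it -/
  σ : S → ℂ

/-- `(S, σ) ≤ (T, τ)` if `S ≤ T` and `σ` is an irreducible constituent of `τ_S`. -/
instance {G : Type u} [Group G] : LE (CharPair G) where
  le P Q := ∃ h : P.S ≤ Q.S, IsIrrConstituent P.σ (fun s => Q.σ (Subgroup.inclusion h s))

/-- `(S, σ)` is a `π`-factored subnormal pair for `χ`. -/
def IsFactoredSubnormalPair {G : Type u} [Group G] (π : Set Nat.Primes) (χ : G → ℂ)
    (P : CharPair G) : Prop :=
  P.S.IsSubnormal ∧ IsIrrConstituent P.σ (res P.S χ) ∧ IsPiFactored π P.σ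

/-- The stabilizer of `(S, σ)` in `G`: all `g` that normalize `S` and satisfy
`σ (g x g⁻¹) = σ x` for every `x` in `S`. -/
def CharPair.stabilizer {G : Type u} [Group G] (P : CharPair G) : Subgroup G where
  carrier := {g | (∀ x : G, x ∈ P.S ↔ g * x * g⁻¹ ∈ P.S) ∧
    ∀ x y : P.S, (y : G) = g * x * g⁻¹ → P.σ y = P.σ x}
  one_mem' := by
    refine ⟨fun x => by simp, fun x y h => ?_⟩
    have : y = x := Subtype.ext (by simpa using h)
    rw [this]
  mul_mem' := by
    rintro a b ⟨ha, ha'⟩ ⟨hb, hb'⟩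
    have e : ∀ x : G, a * b * x * (a * b)⁻¹ = a * (b * x * b⁻¹) * a⁻¹ := fun x => by group
    refine ⟨fun x => by rw [e, ← ha, ← hb], fun x y h => ?_⟩
    rw [ha' ⟨b * x * b⁻¹, (hb x).1 x.2⟩ y (by rw [h, e]), hb' x _ rfl]
  inv_mem' := by
    rintro a ⟨ha, ha'⟩
    have e : ∀ x : G, a * (a⁻¹ * x * a⁻¹⁻¹) * a⁻¹ = x := fun x => by group
    refine ⟨fun x => by rw [ha (a⁻¹ * x * a⁻¹⁻¹), e], fun x y h => ?_⟩
    exact (ha' y x (by rw [h, e])).symm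

open Classical in
/-- The character of the finite group `G` induced from the function `τ` on the subgroup `T`:
`τ^G(g) = |T|⁻¹ ∑_{x ∈ G} τ°(x g x⁻¹)`, where `τ°` is `τ` on `T` and `0` elsewhere. -/
def ind {G : Type*} [Group G] (T : Subgroup G) (τ : T → ℂ) (g : G) : ℂ :=
  (Nat.card T : ℂ)⁻¹ * ∑ᶠ x : G, if h : x * g * x⁻¹ ∈ T then τ ⟨x * g * x⁻¹, h⟩ else 0

/-- A pair in a subgroup `T` of `G`, regarded as a pair in `G`. -/
def CharPair.ofSubgroup {G : Type u} [Group G] (T : Subgroup G) (Q : CharPair T) : CharPair G where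
  S := Q.S.map T.subtype
  σ := fun x => Q.σ ((Q.S.equivMapOfInjective T.subtype T.subtype_injective).symm x)

/-- `IsNucleus π χ (X, η)`: the pair `(X, η)` is a `π`-nucleus for `χ ∈ Irr(G)`.
If `χ` is `π`-factored, it is `(G, χ)`. Otherwise choose a maximal `π`-factored subnormal pair
`(S, σ)` for `χ`, let `T` be its stabilizer and `τ ∈ Irr(T | σ)` with `τ^G = χ`; the
`π`-nuclei of `τ` are then `π`-nuclei of `χ`. -/
inductive IsNucleus (π : Set Nat.Primes) :
    ∀ {G : Type u} [Group G], (G → ℂ) → CharPair G → Prop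
  | factored {G : Type u} [Group G] (χ : G → ℂ) (hχ : IsPiFactored π χ) :
      IsNucleus π χ ⟨⊤, res ⊤ χ⟩
  | step {G : Type u} [Group G] (χ : G → ℂ) (hχ : χ ∈ Irr G) (hnf : ¬ IsPiFactored π χ)
      (P : CharPair G) (hP : Maximal (IsFactoredSubnormalPair π χ) P)
      (τ : P.stabilizer → ℂ) (hτ : τ ∈ Irr P.stabilizer) (hσ : P ≤ ⟨P.stabilizer, τ⟩)
      (hind : ind P.stabilizer τ = χ)
      (Q : CharPair P.stabilizer) (hQ : IsNucleus π τ Q) :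
      IsNucleus π χ (Q.ofSubgroup P.stabilizer)

/-- `B_π(G)`: the irreducible characters of `G` whose `π`-nucleus `(X, η)` (unique up to
conjugacy) has a `π`-special `η`. -/
def B (π : Set Nat.Primes) (G : Type u) [Group G] : Set (G → ℂ) :=
  {χ | χ ∈ Irr G ∧ ∃ Q : CharPair G, IsNucleus π χ Q ∧ IsPiSpecial π Q.σ}

/-- The inflation to `G` of a function on `G ⧸ N`. -/
def inflate {G : Type*} [Group G] (N : Subgroup G) (χ : G ⧸ N → ℂ) : G → ℂ :=
  fun g => χ (QuotientGroup.mk g)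

end BPi

end

/-! Everything is proved for a surjection `f : G →* H` and the inflation `χ ∘ f`; the quotient map
is a special case. The point is that every ingredient of the nucleus construction for `χ ∘ f` is
itself inflated, so the recursion can be copied from `H` to `G` and back.

Three facts carry this. A constituent of an inflated character is inflated, because character values
have real part at most the degree and equality forces the kernel
(`IsIrrConstituent.exists_comp_eq`). If `αβ` is inflated with `α` `π`-special and `β` `π'`-special,
then each factor is inflated, because on `f.ker` both are multiples of mutually inverse linear
characters of coprime order (`mul_kernel_of_special`). If `τ` on `T ≥ f.ker` induces to an inflated
character, then `τ` is trivial on `f.ker` (`IsChar.eq_one_of_ind_eq_comp`).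

Hence each factored subnormal pair lies below one pulled back from `H`. Maximal pairs, stabilizers
and inducing characters therefore correspond, and induction on `IsNucleus` in each direction matches
the nuclei. -/

namespace BPi

open Module Polynomial

/-! ### Traces of complex operators of finite order -/

section FiniteOrder

variable {V : Type*} [AddCommGroup V] [Module ℂ V] [FiniteDimensional ℂ V]

theorem norm_eq_one_of_mem_roots_charpoly {A : End ℂ V} {k : ℕ} (hk : k ≠ 0) (hA : A ^ k = 1)
    {x : ℂ} (hx : x ∈ A.charpoly.roots) : ‖x‖ = 1 := by
  have hev : A.HasEigenvalue x :=
    (End.hasEigenvalue_iff_isRoot_charpoly A x).2 (isRoot_of_mem_roots hx)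
  obtain ⟨v, hv⟩ := hev.exists_hasEigenvector
  have h := hv.pow_apply k
  rw [hA, End.one_apply] at h
  have h1 : x ^ k = 1 := by
    have : (x ^ k - 1) • v = 0 := by rw [sub_smul, ← h, one_smul, sub_self]
    exact sub_eq_zero.1 ((smul_eq_zero.1 this).resolve_right hv.2)
  exact Complex.norm_eq_one_of_pow_eq_one h1 hk

theorem card_roots_charpoly (A : End ℂ V) : A.charpoly.roots.card = finrank ℂ V := by
  rw [← (IsAlgClosed.splits A.charpoly).natDegree_eq_card_roots, LinearMap.charpoly_natDegree]

theorem norm_trace_le_finrank {A : End ℂ V} {k : ℕ} (hk : k ≠ 0) (hA : A ^ k = 1) :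
    ‖LinearMap.trace ℂ V A‖ ≤ finrank ℂ V := by
  rw [End.trace_eq_sum_roots_charpoly_of_splits (IsAlgClosed.splits _), ← card_roots_charpoly A]
  refine (norm_multiset_sum_le _).trans (le_of_eq ?_)
  rw [Multiset.map_congr rfl fun x hx => norm_eq_one_of_mem_roots_charpoly hk hA hx]
  simp

/-- Equality case of the triangle inequality: each `Re (x * conj c)` is at most 1 and they average
to 1, so all are 1. -/
theorem multiset_eq_of_sum_eq_card_mul {s : Multiset ℂ} {c : ℂ} (hc : ‖c‖ = 1)
    (hs : ∀ x ∈ s, ‖x‖ = 1) (h : s.sum = s.card * c) : ∀ x ∈ s, x = c := by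
  have hcc : c * (starRingEnd ℂ) c = 1 := by
    rw [Complex.mul_conj, Complex.normSq_eq_norm_sq, hc]; simp
  have hle : ∀ x ∈ s, 0 ≤ 1 - (x * (starRingEnd ℂ) c).re := fun x hx => by
    have := Complex.re_le_norm (x * (starRingEnd ℂ) c)
    rw [norm_mul, hs x hx, RCLike.norm_conj, hc, one_mul] at this
    linarith
  have hsum : (s.map fun x => 1 - (x * (starRingEnd ℂ) c).re).sum = 0 := by
    have h1 : (s.map fun x => (x * (starRingEnd ℂ) c).re).sum = s.card := by
      have : (s.map fun x => (x * (starRingEnd ℂ) c).re).sum =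
          Complex.reAddGroupHom ((s.map fun x => x * (starRingEnd ℂ) c).sum) := by
        rw [map_multiset_sum, Multiset.map_map]; rfl
      rw [this, Multiset.sum_map_mul_right, Multiset.map_id', h, mul_assoc, hcc]
      simp
    rw [Multiset.sum_map_sub, h1]
    simp
  intro x hx
  have hx0 : 1 - (x * (starRingEnd ℂ) c).re = 0 := by
    refine le_antisymm ?_ (hle x hx)
    rw [← hsum]
    refine Multiset.single_le_sum ?_ _ (Multiset.mem_map_of_mem _ hx)
    intro y hy
    obtain ⟨z, hz, rfl⟩ := Multiset.mem_map.1 hy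
    exact hle z hz
  have hn : ‖x * (starRingEnd ℂ) c‖ = 1 := by
    rw [norm_mul, hs x hx, RCLike.norm_conj, hc, one_mul]
  have hre : (x * (starRingEnd ℂ) c).re = ‖x * (starRingEnd ℂ) c‖ := by rw [hn]; linarith
  have h1 : x * (starRingEnd ℂ) c = 1 := by
    have h2 := (Complex.re_eq_norm.1 hre)
    have h3 := Complex.eq_re_of_ofReal_le (r := 0) (by simpa using h2)
    rw [h3, hre, hn, Complex.ofReal_one]
  calc x = x * (starRingEnd ℂ) c * c := by rw [mul_assoc, mul_comm _ c, hcc, mul_one]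
    _ = c := by rw [h1, one_mul]

theorem eq_algebraMap_of_trace_eq {A : End ℂ V} {k : ℕ} (hk : k ≠ 0) (hA : A ^ k = 1) {c : ℂ}
    (hc : ‖c‖ = 1) (h : LinearMap.trace ℂ V A = finrank ℂ V * c) : A = algebraMap ℂ _ c := by
  rw [End.trace_eq_sum_roots_charpoly_of_splits (IsAlgClosed.splits _),
    ← card_roots_charpoly A] at h
  have hroots := Multiset.eq_replicate.2
    ⟨rfl, multiset_eq_of_sum_eq_card_mul hc
      (fun x hx => norm_eq_one_of_mem_roots_charpoly hk hA hx) h⟩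
  have hpoly : A.charpoly = (X - C c) ^ A.charpoly.roots.card := by
    conv_lhs => rw [(IsAlgClosed.splits A.charpoly).eq_prod_roots_of_monic A.charpoly_monic, hroots]
    simp
  -- All eigenvalues equal `c`; diagonalizability comes from separability of `X ^ k - 1`. A
  -- squarefree divisor of a power of `X - c` divides `X - c`.
  have hsq : Squarefree (minpoly ℂ A) := by
    refine Squarefree.squarefree_of_dvd (minpoly.dvd ℂ A (p := X ^ k - C 1) (by simp [hA])) ?_
    exact (separable_X_pow_sub_C 1 (Nat.cast_ne_zero.2 hk) one_ne_zero).squarefree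
  have hdvd : minpoly ℂ A ∣ (X - C c) ^ A.charpoly.roots.card := by
    rw [← hpoly]; exact minpoly.dvd ℂ A A.aeval_self_charpoly
  obtain ⟨q, hq⟩ := hsq.isRadical _ _ hdvd
  have : aeval A (X - C c) = 0 := by rw [hq, map_mul, minpoly.aeval, zero_mul]
  simpa [sub_eq_zero] using this

end FiniteOrder

/-! ### Inflation of characters and of `π`-special characters -/

section Characters

variable {G H : Type*} [Group G] [Group H]

theorem IsChar.of_mem_irr {χ : G → ℂ} (h : χ ∈ Irr G) : IsChar χ :=
  let ⟨n, ρ, _, e⟩ := h; ⟨n, ρ, e⟩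

theorem isChar_zero : IsChar (0 : G → ℂ) :=
  ⟨0, 1, by ext g; simp [Representation.character]⟩

theorem isIrrConstituent_self {χ : G → ℂ} (h : χ ∈ Irr G) : IsIrrConstituent χ χ :=
  ⟨h, 0, isChar_zero, (add_zero χ).symm⟩

theorem rep_pow_card [Finite G] {n : ℕ} (ρ : Representation ℂ G (Fin n → ℂ)) (g : G) :
    ρ g ^ Nat.card G = 1 := by
  rw [← map_pow, pow_card_eq_one', map_one]

theorem IsChar.norm_le [Finite G] {χ : G → ℂ} (h : IsChar χ) (g : G) : ‖χ g‖ ≤ (χ 1).re := by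
  obtain ⟨n, ρ, rfl⟩ := h
  have := norm_trace_le_finrank Nat.card_pos.ne' (rep_pow_card ρ g)
  simpa [Representation.character] using this

theorem IsChar.re_le [Finite G] {χ : G → ℂ} (h : IsChar χ) (g : G) : (χ g).re ≤ (χ 1).re :=
  (Complex.re_le_norm _).trans (h.norm_le g)

theorem IsChar.eq_of_re_eq [Finite G] {χ : G → ℂ} (h : IsChar χ) {g : G}
    (hg : (χ g).re = (χ 1).re) : χ g = χ 1 := by
  have h1 : (χ g).re = ‖χ g‖ :=
    le_antisymm (Complex.re_le_norm _) (hg ▸ h.norm_le g)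
  have h2 : (χ g).im = 0 := by
    have := (Complex.re_eq_norm.1 h1)
    exact (Complex.le_def.1 this).2.symm
  have h3 : (χ 1).im = 0 := by
    obtain ⟨n, ρ, rfl⟩ := h
    simp
  exact Complex.ext hg (h2.trans h3.symm)

theorem rep_eq_one_of_character_eq [Finite G] {n : ℕ} (ρ : Representation ℂ G (Fin n → ℂ)) {g : G}
    (h : ρ.character g = ρ.character 1) : ρ g = 1 := by
  have := eq_algebraMap_of_trace_eq Nat.card_pos.ne' (rep_pow_card ρ g) (c := 1) (by simp)
    (by simpa [Representation.character] using h)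
  simpa using this

/-- A representation that is trivial on the kernel of a surjection `f` factors through `f`. -/
theorem exists_rep_comp_eq {f : G →* H} (hf : Function.Surjective f) {V : Type*} [AddCommGroup V]
    [Module ℂ V] (ρ : Representation ℂ G V) (hρ : ∀ k, f k = 1 → ρ k = 1) :
    ∃ ρ' : Representation ℂ H V, ρ'.comp f = ρ := by
  have key : ∀ a b, f a = f b → ρ a = ρ b := fun a b hab => by
    have h1 : ρ (a * b⁻¹) = 1 := hρ _ (by rw [map_mul, map_inv, hab, mul_inv_cancel])
    calc ρ a = ρ (a * b⁻¹) * ρ b := by rw [← map_mul, inv_mul_cancel_right]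
      _ = ρ b := by rw [h1, one_mul]
  have hs := Function.surjInv_eq hf
  refine ⟨⟨⟨fun h => ρ (Function.surjInv hf h), ?_⟩, fun a b => ?_⟩, ?_⟩
  · exact hρ _ (hs 1)
  · rw [← map_mul]
    exact key _ _ (by rw [hs, map_mul, hs, hs])
  · ext1 g
    exact key _ _ (hs _)

theorem isIrreducible_comp_iff {f : G →* H} (hf : Function.Surjective f) {V : Type*}
    [AddCommGroup V] [Module ℂ V] (ρ : Representation ℂ H V) :
    Representation.IsIrreducible (ρ.comp f : Representation ℂ G V) ↔ ρ.IsIrreducible := by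
  let e : Subrepresentation (ρ.comp f : Representation ℂ G V) ≃o Subrepresentation ρ :=
    { toFun := fun W => ⟨W.toSubmodule, fun h v hv => by
        obtain ⟨g, rfl⟩ := hf h
        exact W.apply_mem_toSubmodule g hv⟩
      invFun := fun W => ⟨W.toSubmodule, fun g v hv => W.apply_mem_toSubmodule (f g) hv⟩
      left_inv := fun _ => rfl
      right_inv := fun _ => rfl
      map_rel_iff' := Iff.rfl }
  exact e.isSimpleOrder_iff

variable [Finite G] {f : G →* H}

theorem isChar_comp_iff (hf : Function.Surjective f) {χ : H → ℂ} :
    IsChar (χ ∘ f) ↔ IsChar χ := by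
  constructor
  · rintro ⟨n, ρ, h⟩
    obtain ⟨ρ', rfl⟩ := exists_rep_comp_eq hf ρ fun k hk =>
      rep_eq_one_of_character_eq ρ (by rw [h]; simp [hk])
    exact ⟨n, ρ', hf.injective_comp_right h⟩
  · rintro ⟨n, ρ, rfl⟩
    exact ⟨n, ρ.comp f, rfl⟩

theorem comp_mem_irr_iff (hf : Function.Surjective f) {χ : H → ℂ} :
    χ ∘ f ∈ Irr G ↔ χ ∈ Irr H := by
  constructor
  · rintro ⟨n, ρ, hi, h⟩
    obtain ⟨ρ', rfl⟩ := exists_rep_comp_eq hf ρ fun k hk =>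
      rep_eq_one_of_character_eq ρ (by rw [h]; simp [hk])
    exact ⟨n, ρ', (isIrreducible_comp_iff hf ρ').1 hi, hf.injective_comp_right h⟩
  · rintro ⟨n, ρ, hi, rfl⟩
    exact ⟨n, ρ.comp f, (isIrreducible_comp_iff hf ρ).2 hi, rfl⟩

theorem IsChar.exists_comp_eq (hf : Function.Surjective f) {χ : G → ℂ} (hχ : IsChar χ)
    (h : ∀ k, f k = 1 → χ k = χ 1) : ∃ χ' : H → ℂ, χ = χ' ∘ f := by
  obtain ⟨n, ρ, rfl⟩ := hχ
  obtain ⟨ρ', rfl⟩ := exists_rep_comp_eq hf ρ fun k hk => rep_eq_one_of_character_eq ρ (h k hk)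
  exact ⟨ρ'.character, rfl⟩

theorem isIrrConstituent_comp_iff (hf : Function.Surjective f) {ψ χ : H → ℂ} :
    IsIrrConstituent (ψ ∘ f) (χ ∘ f) ↔ IsIrrConstituent ψ χ := by
  refine and_congr (comp_mem_irr_iff hf) ⟨?_, ?_⟩
  · rintro ⟨θ, hθ, h⟩
    have : θ = (χ - ψ) ∘ f := by rw [eq_comm, Pi.sub_comp, h, add_sub_cancel_left]
    exact ⟨χ - ψ, (isChar_comp_iff hf).1 (this ▸ hθ), (add_sub_cancel ψ χ).symm⟩
  · rintro ⟨θ, hθ, rfl⟩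
    exact ⟨θ ∘ f, (isChar_comp_iff hf).2 hθ, rfl⟩

/-- An irreducible constituent of an inflated character is inflated. -/
theorem IsIrrConstituent.exists_comp_eq (hf : Function.Surjective f) {ψ : G → ℂ} {χ : H → ℂ}
    (h : IsIrrConstituent ψ (χ ∘ f)) : ∃ ψ' : H → ℂ, ψ = ψ' ∘ f := by
  obtain ⟨hψ, θ, hθ, e⟩ := h
  have hψ := IsChar.of_mem_irr hψ
  refine hψ.exists_comp_eq hf fun k hk => hψ.eq_of_re_eq (le_antisymm (hψ.re_le k) ?_)
  -- The sum is constant on the kernel and neither summand can exceed its real part at 1, so neither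
  -- drops below it.
  have h1 : ψ k + θ k = ψ 1 + θ 1 := by
    have := (congrFun e k).symm.trans ((show χ (f k) = χ (f 1) by rw [hk, map_one]).trans
      (congrFun e 1))
    exact this
  have h2 := congrArg Complex.re h1
  have h3 := hθ.re_le k
  simp only [Complex.add_re] at h2
  linarith

theorem hasPiDetOrder_comp_iff (hf : Function.Surjective f) {π : Set Nat.Primes} {χ : H → ℂ} :
    HasPiDetOrder π (χ ∘ f) ↔ HasPiDetOrder π χ := by
  have key : ∀ (n : ℕ) (ρ : Representation ℂ H (Fin n → ℂ)),
      orderOf ((LinearMap.det : End ℂ (Fin n → ℂ) →* ℂ).comp (ρ.comp f)) =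
        orderOf ((LinearMap.det : End ℂ (Fin n → ℂ) →* ℂ).comp ρ) := fun n ρ => by
    rw [orderOf_eq_orderOf_iff]
    intro k
    rw [MonoidHom.ext_iff, MonoidHom.ext_iff]
    exact (hf.forall (p := fun h =>
      (((LinearMap.det : End ℂ (Fin n → ℂ) →* ℂ).comp ρ) ^ k) h = (1 : H →* ℂ) h)).symm
  constructor
  · rintro ⟨n, ρ, h, ho⟩
    obtain ⟨ρ', rfl⟩ := exists_rep_comp_eq hf ρ fun k hk =>
      rep_eq_one_of_character_eq ρ (by rw [h]; simp [hk])
    exact ⟨n, ρ', hf.injective_comp_right h, key n ρ' ▸ ho⟩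
  · rintro ⟨n, ρ, rfl, ho⟩
    exact ⟨n, ρ.comp f, rfl, (key n ρ).symm ▸ ho⟩

/-- Subnormality passes to preimages and to images under `f`. A subnormal `S` of `G` need not
contain the kernel, but constituents of the restriction to `S` are inflated along `S → f(S)`. -/
theorem isPiSpecial_comp_iff (hf : Function.Surjective f) {π : Set Nat.Primes} {χ : H → ℂ} :
    IsPiSpecial π (χ ∘ f) ↔ IsPiSpecial π χ := by
  refine and_congr (comp_mem_irr_iff hf) (and_congr (by simp) ⟨fun h S hS ψ hψ => ?_,
    fun h S hS ψ hψ => ?_⟩)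
  · have hs := f.subgroupComap_surjective_of_surjective S hf
    exact (hasPiDetOrder_comp_iff hs).1
      (h (S.comap f) (hS.comap f) _ ((isIrrConstituent_comp_iff hs).2 hψ))
  · have hs := f.subgroupMap_surjective S
    have e : res S (χ ∘ f) = res (S.map f) χ ∘ f.subgroupMap S := rfl
    rw [e] at hψ
    obtain ⟨ψ, rfl⟩ := hψ.exists_comp_eq hs
    exact (hasPiDetOrder_comp_iff hs).2
      (h (S.map f) (hS.map hf) ψ ((isIrrConstituent_comp_iff hs).1 hψ))

end Characters

open Module

/-! ### Factored characters under inflation -/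

section Factored

variable {G H : Type*} [Group G] [Group H]

/-- The representation of dimension `n` on which `G` acts by scalars through `c`. -/
noncomputable def scalarRep (c : G →* ℂ) (n : ℕ) : Representation ℂ G (Fin n → ℂ) :=
  (algebraMap ℂ (End ℂ (Fin n → ℂ)) : ℂ →* End ℂ (Fin n → ℂ)).comp c

theorem character_scalarRep (c : G →* ℂ) (n : ℕ) :
    (scalarRep c n).character = fun g => n * c g := by
  ext g
  simp [Representation.character, scalarRep, Algebra.algebraMap_eq_smul_one, mul_comm]

theorem coe_mem_irr (c : G →* ℂ) : (c : G → ℂ) ∈ Irr G := by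
  refine ⟨1, scalarRep c 1, ?_, by rw [character_scalarRep]; simp⟩
  have hs : IsSimpleOrder (Submodule ℂ (Fin 1 → ℂ)) :=
    (isSimpleModule_iff ℂ _).1 (isSimpleModule_iff_finrank_eq_one.2 (by simp))
  refine { exists_pair_ne := ⟨⊥, ⊤, fun h => ?_⟩, eq_bot_or_eq_top := fun W => ?_ }
  · exact bot_ne_top (congrArg Subrepresentation.toSubmodule h)
  · exact (hs.eq_bot_or_eq_top W.toSubmodule).imp
      (fun h => Subrepresentation.toSubmodule_injective h)
      (fun h => Subrepresentation.toSubmodule_injective h)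

theorem HasPiDetOrder.orderOf_linear {π : Set Nat.Primes} {c : G →* ℂ}
    (h : HasPiDetOrder π (c : G → ℂ)) : IsPiNumber π (orderOf c) := by
  obtain ⟨n, ρ, h, ho⟩ := h
  obtain rfl : n = 1 := by
    have := congrFun h 1
    simpa using this
  have e : (LinearMap.det : End ℂ (Fin 1 → ℂ) →* ℂ).comp ρ = c := by
    ext g
    rw [← h, Representation.character, MonoidHom.comp_apply, ← LinearMap.det_toMatrix',
      LinearMap.trace_eq_matrix_trace ℂ (Pi.basisFun ℂ (Fin 1)), Matrix.det_fin_one,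
      Matrix.trace_fin_one]
    rfl
  rwa [e] at ho

/-- If a `π`-special character restricts to a multiple of a linear character of a normal subgroup,
then the order of that linear character is a `π`-number. -/
theorem IsPiSpecial.isPiNumber_orderOf {π : Set Nat.Primes} {α : G → ℂ} (hα : IsPiSpecial π α)
    {M : Subgroup G} [M.Normal] {c : M →* ℂ} {n : ℕ} (hn : n ≠ 0)
    (h : ∀ m : M, α m = n * c m) : IsPiNumber π (orderOf c) := by
  refine HasPiDetOrder.orderOf_linear (hα.2.2 M (Subgroup.Normal.isSubnormal ‹_›) _
    -- The complement of one copy of `c` is `n - 1` further copies, the zero representation when `n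
    -- = 1`.
    ⟨coe_mem_irr c, _, ⟨n - 1, scalarRep c (n - 1), rfl⟩, ?_⟩)
  rw [character_scalarRep]
  ext m
  simp only [res, Pi.add_apply, h, Nat.cast_sub (Nat.one_le_iff_ne_zero.2 hn)]
  push_cast
  ring

theorem IsChar.exists_linear [Finite G] {α : G → ℂ} (hα : IsChar α) {n : ℕ} (hn : n ≠ 0)
    (h1 : α 1 = n) {M : Subgroup G} (h : ∀ m : M, ‖α m‖ = n) :
    ∃ c : M →* ℂ, ∀ m : M, α m = n * c m := by
  obtain ⟨k, ρ, rfl⟩ := hα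
  obtain rfl : k = n := by simpa using h1
  have hk : (k : ℂ) ≠ 0 := Nat.cast_ne_zero.2 hn
  have hρ : ∀ m : M, ρ m = algebraMap ℂ _ (ρ.character m / k) := fun m => by
    refine eq_algebraMap_of_trace_eq Nat.card_pos.ne' (rep_pow_card ρ m) ?_ ?_
    · rw [norm_div, h, Complex.norm_natCast, div_self (Nat.cast_ne_zero.2 hn)]
    · rw [finrank_fin_fun, mul_div_cancel₀ _ hk]; rfl
  have : Nonempty (Fin k) := ⟨⟨0, Nat.pos_of_ne_zero hn⟩⟩
  have hinj := (algebraMap ℂ (End ℂ (Fin k → ℂ))).injective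
  refine ⟨⟨⟨fun m => ρ.character m / k, ?_⟩, fun a b => ?_⟩, fun m => ?_⟩
  · rw [Subgroup.coe_one, h1, div_self hk]
  · apply hinj
    rw [map_mul, ← hρ a, ← hρ b, ← hρ (a * b), Subgroup.coe_mul, map_mul]
  · exact (mul_div_cancel₀ _ hk).symm

theorem IsPiNumber.eq_one {π : Set Nat.Primes} {n : ℕ} (h : IsPiNumber π n)
    (h' : IsPiNumber πᶜ n) : n = 1 := by
  by_contra hn
  obtain ⟨p, hp, hd⟩ := Nat.exists_prime_and_dvd hn
  exact h'.2 ⟨p, hp⟩ hd (h.2 ⟨p, hp⟩ hd)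

/-- The bounds `‖α m‖ ≤ α 1` and `‖β m‖ ≤ β 1` must both be attained, so `M` acts by scalars `c` and
`d` with `c * d = 1`. These have the same order, which is both a `π`-number and a `π'`-number, hence
1. -/
theorem mul_kernel_of_special [Finite G] {π : Set Nat.Primes} {α β : G → ℂ}
    (hα : IsPiSpecial π α) (hβ : IsPiSpecial πᶜ β) {M : Subgroup G} [M.Normal]
    (h : ∀ m : M, α m * β m = α 1 * β 1) :
    (∀ m : M, α m = α 1) ∧ ∀ m : M, β m = β 1 := by
  obtain ⟨a, ha, ha'⟩ := hα.2.1
  obtain ⟨b, hb, hb'⟩ := hβ.2.1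
  have hαc := IsChar.of_mem_irr hα.1
  have hβc := IsChar.of_mem_irr hβ.1
  have ha0 : (0 : ℝ) < a := Nat.cast_pos.2 (Nat.pos_of_ne_zero ha'.1)
  have hb0 : (0 : ℝ) < b := Nat.cast_pos.2 (Nat.pos_of_ne_zero hb'.1)
  have hle (m : M) : ‖α m‖ ≤ a := by simpa [ha] using hαc.norm_le (m : G)
  have hle' (m : M) : ‖β m‖ ≤ b := by simpa [hb] using hβc.norm_le (m : G)
  have hmul (m : M) : ‖α m‖ * ‖β m‖ = a * b := by
    rw [← norm_mul, h, ha, hb, norm_mul, Complex.norm_natCast, Complex.norm_natCast]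
  obtain ⟨c, hc⟩ := hαc.exists_linear ha'.1 ha fun m => le_antisymm (hle m) (by
    have := mul_le_mul_of_nonneg_left (hle' m) (norm_nonneg (α m))
    rw [hmul] at this
    exact le_of_mul_le_mul_right this hb0)
  obtain ⟨d, hd⟩ := hβc.exists_linear hb'.1 hb fun m => le_antisymm (hle' m) (by
    have := mul_le_mul_of_nonneg_right (hle m) (norm_nonneg (β m))
    rw [hmul] at this
    exact le_of_mul_le_mul_left this ha0)
  have hcd : c * d = 1 := by
    ext m
    have ha1 : (a : ℂ) ≠ 0 := Nat.cast_ne_zero.2 ha'.1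
    have hb1 : (b : ℂ) ≠ 0 := Nat.cast_ne_zero.2 hb'.1
    have := h m
    rw [hc, hd, ha, hb] at this
    refine mul_left_cancel₀ (mul_ne_zero ha1 hb1) ?_
    simp only [MonoidHom.mul_apply, MonoidHom.one_apply]
    linear_combination this
  have hord : orderOf c = orderOf d := by
    rw [orderOf_eq_orderOf_iff]
    intro k
    have : c ^ k * d ^ k = 1 := by rw [← mul_pow, hcd, one_pow]
    constructor <;> intro h0 <;> simpa [h0] using this
  have hc1 : c = 1 := orderOf_eq_one_iff.1
    ((hα.isPiNumber_orderOf ha'.1 hc).eq_one (hord ▸ hβ.isPiNumber_orderOf hb'.1 hd))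
  have hd1 : d = 1 := by simpa [hc1] using hcd
  exact ⟨fun m => by simp [hc, hc1, ha], fun m => by simp [hd, hd1, hb]⟩

theorem isPiFactored_comp_iff [Finite G] {f : G →* H} (hf : Function.Surjective f)
    {π : Set Nat.Primes} {χ : H → ℂ} : IsPiFactored π (χ ∘ f) ↔ IsPiFactored π χ := by
  refine and_congr (comp_mem_irr_iff hf) ⟨?_, ?_⟩
  · rintro ⟨α, β, hα, hβ, h⟩
    have hker := mul_kernel_of_special hα hβ (M := f.ker) fun m => by
      have hm : f m = f 1 := (f.mem_ker.1 m.2).trans f.map_one.symm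
      calc α m * β m = χ (f m) := (congrFun h m).symm
        _ = α 1 * β 1 := by rw [hm]; exact congrFun h 1
    obtain ⟨α, rfl⟩ := (IsChar.of_mem_irr hα.1).exists_comp_eq hf fun k hk => hker.1 ⟨k, hk⟩
    obtain ⟨β, rfl⟩ := (IsChar.of_mem_irr hβ.1).exists_comp_eq hf fun k hk => hker.2 ⟨k, hk⟩
    exact ⟨α, β, (isPiSpecial_comp_iff hf).1 hα, (isPiSpecial_comp_iff hf).1 hβ,
      hf.injective_comp_right h⟩
  · rintro ⟨α, β, hα, hβ, rfl⟩
    exact ⟨α ∘ f, β ∘ f, (isPiSpecial_comp_iff hf).2 hα, (isPiSpecial_comp_iff hf).2 hβ, rfl⟩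

end Factored

/-! ### Induction and inflation -/

section Induced

variable {G H : Type*} [Group G] [Group H] [Finite G] {f : G →* H}

theorem finsum_comp_eq_card_ker_mul (hf : Function.Surjective f) (F : H → ℂ) :
    ∑ᶠ x, F (f x) = Nat.card f.ker * ∑ᶠ y, F y := by
  classical
  have := Finite.of_surjective f hf
  have := Fintype.ofFinite G
  have := Fintype.ofFinite H
  rw [finsum_eq_sum_of_fintype, finsum_eq_sum_of_fintype, Finset.mul_sum,
    ← Finset.sum_fiberwise (g := f)]
  refine Finset.sum_congr rfl fun y _ => ?_
  rw [Finset.sum_congr rfl fun x hx => by rw [(Finset.mem_filter.1 hx).2], Finset.sum_const,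
    nsmul_eq_mul, MonoidHom.card_fiber_eq_of_mem_range f (hf y) ⟨1, map_one f⟩,
    ← Nat.subtype_card _ (by simp [MonoidHom.mem_ker] : ∀ x, _ ↔ x ∈ f.ker)]

theorem card_comap_of_surjective (hf : Function.Surjective f) (T : Subgroup H) :
    Nat.card (T.comap f) = Nat.card f.ker * Nat.card T := by
  have := Finite.of_surjective f hf
  have h1 := (T.comap f).card_mul_index
  have h2 := T.card_mul_index
  have h3 := f.ker.card_mul_index
  rw [Subgroup.index_comap_of_surjective _ hf] at h1
  rw [Subgroup.index_ker, MonoidHom.range_eq_top.2 hf, Subgroup.card_top] at h3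
  refine Nat.eq_of_mul_eq_mul_right (Nat.pos_of_ne_zero T.index_ne_zero_of_finite) ?_
  rw [h1, mul_assoc, h2, h3]

/-- The factor `|ker f|` from summing over fibres cancels against `|T'| = |ker f| |T|`. `T'` is kept
separate from `T.comap f` so that it can be the stabilizer of an inflated pair. -/
theorem ind_comp (hf : Function.Surjective f) {T : Subgroup H} {T' : Subgroup G}
    (hT : T' = T.comap f) (fT : T' →* T) (hfT : ∀ x, (fT x : H) = f x) (τ : T → ℂ) :
    ind T' (τ ∘ fT) = ind T τ ∘ f := by
  classical
  have := Finite.of_surjective f hf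
  ext g
  let F : H → ℂ := fun y => if h : y * f g * y⁻¹ ∈ T then τ ⟨y * f g * y⁻¹, h⟩ else 0
  have e : ∀ x : G, (if h : x * g * x⁻¹ ∈ T' then (τ ∘ fT) ⟨x * g * x⁻¹, h⟩ else 0) =
      F (f x) := fun x => by
    have hx : f (x * g * x⁻¹) = f x * f g * (f x)⁻¹ := by simp
    by_cases h : f x * f g * (f x)⁻¹ ∈ T
    · have h' : x * g * x⁻¹ ∈ T' := by rwa [hT, Subgroup.mem_comap, hx]
      simp only [F, dif_pos h, dif_pos h', Function.comp_apply]
      exact congrArg τ (Subtype.ext ((hfT _).trans hx))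
    · have h' : x * g * x⁻¹ ∉ T' := by rwa [hT, Subgroup.mem_comap, hx]
      simp only [F, dif_neg h, dif_neg h']
  have hk : (Nat.card f.ker : ℂ) ≠ 0 := Nat.cast_ne_zero.2 Nat.card_pos.ne'
  have hc : (Nat.card T : ℂ) ≠ 0 := Nat.cast_ne_zero.2 Nat.card_pos.ne'
  rw [ind, finsum_congr e, finsum_comp_eq_card_ker_mul hf F, hT, card_comap_of_surjective hf,
    Function.comp_apply, ind]
  push_cast
  field_simp
  rfl

/-- If a character of `T ≥ ker f` induces to an inflated character, its kernel contains `ker f`. -/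
theorem IsChar.eq_one_of_ind_eq_comp {T : Subgroup G} {τ : T → ℂ} (hτ : IsChar τ)
    (hT : f.ker ≤ T) {χ : H → ℂ} (h : ind T τ = χ ∘ f) {k : T} (hk : f k = 1) : τ k = τ 1 := by
  classical
  have := Fintype.ofFinite G
  have hmem : ∀ (g : G), f g = 1 → ∀ x : G, x * g * x⁻¹ ∈ T := fun g hg x =>
    hT (by simp [MonoidHom.mem_ker, hg])
  have key : ∀ g (hg : f g = 1),
      ind T τ g = (Nat.card T : ℂ)⁻¹ * ∑ x, τ ⟨x * g * x⁻¹, hmem g hg x⟩ := fun g hg => by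
    rw [ind, finsum_eq_sum_of_fintype]
    congr 1
    exact Finset.sum_congr rfl fun x _ => dif_pos _
  have h1 : ind T τ k = ind T τ 1 := by
    rw [h, Function.comp_apply, Function.comp_apply, hk, map_one]
  have hc : (Nat.card T : ℂ)⁻¹ ≠ 0 := inv_ne_zero (Nat.cast_ne_zero.2 Nat.card_pos.ne')
  rw [key k hk, key 1 (map_one f)] at h1
  have h2 := congrArg Complex.re (mul_left_cancel₀ hc h1)
  rw [Complex.re_sum, Complex.re_sum] at h2
  have hone : ∀ x : G, (⟨x * 1 * x⁻¹, hmem 1 (map_one f) x⟩ : T) = 1 := fun x =>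
    Subtype.ext (by simp)
  simp only [hone] at h2
  -- Equal sums with termwise bounds force termwise equality; the term at `x = 1` is `τ k`.
  have h3 := (Finset.sum_eq_sum_iff_of_le fun x _ => hτ.re_le _).1 h2 1 (Finset.mem_univ _)
  refine hτ.eq_of_re_eq (h3 ▸ ?_)
  congr 2
  exact Subtype.ext (by simp)

end Induced

/-! ### Factored subnormal pairs and their stabilizers -/

section Pairs

variable {G H : Type u} [Group G] [Group H]

theorem CharPair.eq_of {P Q : CharPair G} (h : P.S = Q.S)
    (h' : ∀ x (hx : x ∈ P.S) (hx' : x ∈ Q.S), P.σ ⟨x, hx⟩ = Q.σ ⟨x, hx'⟩) : P = Q := by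
  obtain ⟨S, σ⟩ := P
  obtain ⟨S', σ'⟩ := Q
  obtain rfl : S = S' := h
  congr 1
  ext ⟨x, hx⟩
  exact h' x hx hx

/-- The inflation of a pair in `H` along a homomorphism to `H`. -/
def CharPair.comap (f : G →* H) (P : CharPair H) : CharPair G where
  S := P.S.comap f
  σ := P.σ ∘ f.subgroupComap P.S

theorem CharPair.stabilizer_comap {f : G →* H} (hf : Function.Surjective f) (P : CharPair H) :
    (P.comap f).stabilizer = P.stabilizer.comap f := by
  ext g
  constructor
  · rintro ⟨h1, h2⟩
    refine ⟨hf.forall.2 fun x => ?_, ?_⟩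
    · simpa [CharPair.comap] using h1 x
    · rintro ⟨x, hx⟩ ⟨y, hy⟩ h
      obtain ⟨x, rfl⟩ := hf x
      have hy' : f (g * x * g⁻¹) = y := by simpa using h.symm
      subst hy'
      exact h2 ⟨x, hx⟩ ⟨g * x * g⁻¹, hy⟩ rfl
  · rintro ⟨h1, h2⟩
    refine ⟨fun x => ?_, ?_⟩
    · simpa [CharPair.comap] using h1 (f x)
    · rintro ⟨x, hx⟩ ⟨y, hy⟩ h
      exact h2 ⟨f x, hx⟩ ⟨f y, hy⟩ (by simpa using congrArg f h)

/-- The homomorphism that a surjection `f` induces between the stabilizers of `P.comap f`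
and `P`. -/
def CharPair.stabilizerMap {f : G →* H} (hf : Function.Surjective f) (P : CharPair H) :
    (P.comap f).stabilizer →* P.stabilizer :=
  (f.comp (P.comap f).stabilizer.subtype).codRestrict P.stabilizer fun x =>
    (P.stabilizer_comap hf ▸ x.2 : (x : G) ∈ P.stabilizer.comap f)

theorem CharPair.stabilizerMap_surjective {f : G →* H} (hf : Function.Surjective f) (P : CharPair H) :
    Function.Surjective (P.stabilizerMap hf) := by
  rintro ⟨y, hy⟩
  obtain ⟨x, rfl⟩ := hf y
  exact ⟨⟨x, P.stabilizer_comap hf ▸ hy⟩, rfl⟩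

theorem CharPair.ofSubgroup_σ {T : Subgroup G} (Q : CharPair T) {x : T} (hx : x ∈ Q.S)
    (hx' : (x : G) ∈ (Q.ofSubgroup T).S) : (Q.ofSubgroup T).σ ⟨x, hx'⟩ = Q.σ ⟨x, hx⟩ :=
  congrArg Q.σ ((MulEquiv.symm_apply_eq _).2 rfl)

theorem CharPair.comap_ofSubgroup {f : G →* H} {T : Subgroup H} {T' : Subgroup G}
    (hT : T' = T.comap f) (fT : T' →* T) (hfT : ∀ x, (fT x : H) = f x) (Q : CharPair T) :
    (Q.comap fT).ofSubgroup T' = (Q.ofSubgroup T).comap f := by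
  subst hT
  refine CharPair.eq_of ?_ ?_
  · ext x
    constructor
    · rintro ⟨y, hy, rfl⟩
      exact ⟨fT y, hy, hfT y⟩
    · rintro ⟨y, hy, hyx⟩
      have hx : f x ∈ T := hyx ▸ y.2
      have hxy : fT ⟨x, hx⟩ = y := Subtype.ext ((hfT _).trans hyx.symm)
      exact ⟨⟨x, hx⟩, (hxy ▸ hy : fT ⟨x, hx⟩ ∈ Q.S), rfl⟩
  · rintro _ ⟨x, hx, rfl⟩ hx'
    refine (CharPair.ofSubgroup_σ (Q.comap fT) hx _).trans ?_
    have hx2 : ((fT x : T) : H) ∈ (Q.ofSubgroup T).S := ⟨fT x, hx, rfl⟩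
    refine (CharPair.ofSubgroup_σ Q (x := fT x) hx hx2).symm.trans ?_
    exact congrArg (Q.ofSubgroup T).σ (Subtype.ext (hfT x))

variable [Finite G] {f : G →* H} {π : Set Nat.Primes}

theorem CharPair.comap_le_comap_iff (hf : Function.Surjective f) {P Q : CharPair H} :
    P.comap f ≤ Q.comap f ↔ P ≤ Q := by
  have hs := f.subgroupComap_surjective_of_surjective P.S hf
  constructor
  · rintro ⟨h, h'⟩
    have hPQ : P.S ≤ Q.S := (Subgroup.comap_le_comap_of_surjective hf).1 h
    exact ⟨hPQ, (isIrrConstituent_comp_iff hs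
      (χ := fun s => Q.σ (Subgroup.inclusion hPQ s))).1 h'⟩
  · rintro ⟨h, h'⟩
    exact ⟨(Subgroup.comap_le_comap_of_surjective hf).2 h, (isIrrConstituent_comp_iff hs).2 h'⟩

theorem isFactoredSubnormalPair_comap_iff (hf : Function.Surjective f) {χ : H → ℂ}
    {P : CharPair H} :
    IsFactoredSubnormalPair π (χ ∘ f) (P.comap f) ↔ IsFactoredSubnormalPair π χ P := by
  have hs := f.subgroupComap_surjective_of_surjective P.S hf
  refine and_congr ⟨fun h => ?_, fun h => h.comap f⟩ (and_congr ?_ (isPiFactored_comp_iff hs))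
  · have := h.map hf
    rwa [CharPair.comap, Subgroup.map_comap_eq_self_of_surjective hf] at this
  · exact isIrrConstituent_comp_iff (χ := res P.S χ) hs

/-- The character of the pair is inflated along `R.S → f(R.S)`, so the pair can be enlarged to the
preimage of its image. In particular a maximal pair contains `f.ker` and is pulled back from `H`. -/
theorem IsFactoredSubnormalPair.exists_le_comap (hf : Function.Surjective f) {χ : H → ℂ}
    {R : CharPair G} (hR : IsFactoredSubnormalPair π (χ ∘ f) R) :
    ∃ P : CharPair H, IsFactoredSubnormalPair π χ P ∧ R ≤ P.comap f ∧
      (f.ker ≤ R.S → R = P.comap f) := by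
  have hs := f.subgroupMap_surjective R.S
  have hc : IsIrrConstituent R.σ (res (R.S.map f) χ ∘ f.subgroupMap R.S) := hR.2.1
  obtain ⟨σ, hσ⟩ := hc.exists_comp_eq hs
  have hle : R.S ≤ (R.S.map f).comap f := Subgroup.le_comap_map f R.S
  refine ⟨⟨R.S.map f, σ⟩, ⟨hR.1.map hf, ?_, ?_⟩, ⟨hle, ?_⟩, fun hker => ?_⟩
  · rw [hσ] at hc
    exact (isIrrConstituent_comp_iff hs).1 hc
  · exact (isPiFactored_comp_iff hs).1 (hσ ▸ hR.2.2)
  · change IsIrrConstituent R.σ (σ ∘ f.subgroupMap R.S)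
    rw [← hσ]
    exact isIrrConstituent_self hR.2.1.1
  · refine CharPair.eq_of (Subgroup.comap_map_eq_self hker).symm fun x hx _ => ?_
    rw [hσ]
    rfl

theorem maximal_comap (hf : Function.Surjective f) {χ : H → ℂ} {P : CharPair H}
    (hP : Maximal (IsFactoredSubnormalPair π χ) P) :
    Maximal (IsFactoredSubnormalPair π (χ ∘ f)) (P.comap f) := by
  refine ⟨(isFactoredSubnormalPair_comap_iff hf).2 hP.1, fun R hR hle => ?_⟩
  obtain ⟨Q, hQ, -, h⟩ := hR.exists_le_comap hf
  obtain rfl := h ((f.ker_le_comap P.S).trans hle.1)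
  exact (CharPair.comap_le_comap_iff hf).2 (hP.2 hQ ((CharPair.comap_le_comap_iff hf).1 hle))

theorem exists_eq_comap_of_maximal (hf : Function.Surjective f) {χ : H → ℂ} {R : CharPair G}
    (hR : Maximal (IsFactoredSubnormalPair π (χ ∘ f)) R) :
    ∃ P : CharPair H, R = P.comap f ∧ Maximal (IsFactoredSubnormalPair π χ) P := by
  obtain ⟨P, hP, hle, h⟩ := hR.1.exists_le_comap hf
  obtain rfl := h ((f.ker_le_comap P.S).trans
    (hR.2 ((isFactoredSubnormalPair_comap_iff hf).2 hP) hle).1)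
  exact ⟨P, rfl, hP, fun Q hQ hPQ => (CharPair.comap_le_comap_iff hf).1
    (hR.2 ((isFactoredSubnormalPair_comap_iff hf).2 hQ) ((CharPair.comap_le_comap_iff hf).2 hPQ))⟩

theorem CharPair.comap_le_stabilizer_iff (hf : Function.Surjective f) {P : CharPair H}
    {τ : P.stabilizer → ℂ} :
    P.comap f ≤ ⟨(P.comap f).stabilizer, τ ∘ P.stabilizerMap hf⟩ ↔ P ≤ ⟨P.stabilizer, τ⟩ := by
  rw [← CharPair.comap_le_comap_iff hf]
  suffices (⟨(P.comap f).stabilizer, τ ∘ P.stabilizerMap hf⟩ : CharPair G) =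
      (⟨P.stabilizer, τ⟩ : CharPair H).comap f by rw [this]
  exact CharPair.eq_of (P.stabilizer_comap hf) fun x hx hx' => rfl

end Pairs

/-! ### Transfer of nuclei -/

section Nuclei

variable {π : Set Nat.Primes}

theorem CharPair.top_comap {G H : Type u} [Group G] [Group H] (f : G →* H) (χ : H → ℂ) :
    (⟨⊤, res ⊤ (χ ∘ f)⟩ : CharPair G) = CharPair.comap f ⟨⊤, res ⊤ χ⟩ :=
  CharPair.eq_of (Subgroup.comap_top f).symm fun _ _ _ => rfl

/-- Nuclei inflate to nuclei. -/
theorem IsNucleus.comap {H : Type u} [Group H] {χ : H → ℂ} {Q : CharPair H}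
    (h : IsNucleus π χ Q) : ∀ {G : Type u} [Group G] [Finite G] {f : G →* H},
      Function.Surjective f → IsNucleus π (χ ∘ f) (Q.comap f) := by
  induction h with
  | factored χ hχ =>
    intro G _ _ f hf
    rw [← CharPair.top_comap]
    exact .factored _ ((isPiFactored_comp_iff hf).2 hχ)
  | step χ hχ hnf P hP τ hτ hσ hind Q hQ ih =>
    intro G _ _ f hf
    -- The recursion continues along the surjection of stabilizers instead of `f`, which is why the
    -- group and the surjection are quantified inside the induction.
    have hs := P.stabilizerMap_surjective hf
    rw [← CharPair.comap_ofSubgroup (P.stabilizer_comap hf) (P.stabilizerMap hf) fun _ => rfl]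
    refine .step _ ((comp_mem_irr_iff hf).2 hχ) (mt (isPiFactored_comp_iff hf).1 hnf)
      (P.comap f) (maximal_comap hf hP) (τ ∘ P.stabilizerMap hf) ((comp_mem_irr_iff hs).2 hτ)
      ((CharPair.comap_le_stabilizer_iff hf).2 hσ) ?_ _ (ih hs)
    rw [ind_comp hf (P.stabilizer_comap hf) (P.stabilizerMap hf) fun _ => rfl, hind]

/-- Every nucleus of an inflated character is the inflation of a nucleus. -/
theorem IsNucleus.exists_eq_comap {G : Type u} [Group G] {ψ : G → ℂ} {R : CharPair G}
    (h : IsNucleus π ψ R) : ∀ [Finite G] {H : Type u} [Group H] {f : G →* H},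
      Function.Surjective f → ∀ χ : H → ℂ, ψ = χ ∘ f →
        ∃ Q : CharPair H, IsNucleus π χ Q ∧ R = Q.comap f := by
  induction h with
  | factored ψ hψ =>
    rintro _ H _ f hf χ rfl
    exact ⟨_, .factored χ ((isPiFactored_comp_iff hf).1 hψ), CharPair.top_comap f χ⟩
  | step ψ hψ hnf P hP τ hτ hσ hind R hR ih =>
    rintro _ H _ f hf χ rfl
    obtain ⟨P, rfl, hPmax⟩ := exists_eq_comap_of_maximal hf hP
    have hs := P.stabilizerMap_surjective hf
    -- `τ` descends because it induces to an inflated character and its group contains `f.ker`.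
    obtain ⟨τ, rfl⟩ := (IsChar.of_mem_irr hτ).exists_comp_eq hs fun k hk =>
      (IsChar.of_mem_irr hτ).eq_one_of_ind_eq_comp
        (P.stabilizer_comap hf ▸ f.ker_le_comap P.stabilizer) hind (congrArg Subtype.val hk)
    obtain ⟨Q, hQ, rfl⟩ := ih hs τ rfl
    rw [ind_comp hf (P.stabilizer_comap hf) (P.stabilizerMap hf) fun _ => rfl] at hind
    exact ⟨Q.ofSubgroup P.stabilizer,
      .step χ ((comp_mem_irr_iff hf).1 hψ) (mt (isPiFactored_comp_iff hf).2 hnf) P hPmax τ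
        ((comp_mem_irr_iff hs).1 hτ) ((CharPair.comap_le_stabilizer_iff hf).1 hσ)
        (hf.injective_comp_right hind) Q hQ,
      CharPair.comap_ofSubgroup (P.stabilizer_comap hf) (P.stabilizerMap hf) (fun _ => rfl) Q⟩

theorem comp_mem_B_iff {G H : Type u} [Group G] [Group H] [Finite G] {f : G →* H}
    (hf : Function.Surjective f) {χ : H → ℂ} : χ ∘ f ∈ B π G ↔ χ ∈ B π H := by
  refine and_congr (comp_mem_irr_iff hf) ⟨?_, ?_⟩
  · rintro ⟨R, hR, hsp⟩
    obtain ⟨Q, hQ, rfl⟩ := hR.exists_eq_comap hf χ rfl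
    exact ⟨Q, hQ, (isPiSpecial_comp_iff (f.subgroupComap_surjective_of_surjective Q.S hf)).1 hsp⟩
  · rintro ⟨Q, hQ, hsp⟩
    exact ⟨Q.comap f, hQ.comap hf,
      (isPiSpecial_comp_iff (f.subgroupComap_surjective_of_surjective Q.S hf)).2 hsp⟩

end Nuclei

end BPi

theorem theorem1 (π : Set Nat.Primes) (G : Type*) [Group G] [Finite G]
    (hG : BPi.IsPiSeparable π G) (N : Subgroup G) [N.Normal] :
    BPi.inflate N '' BPi.B π (G ⧸ N) = (BPi.inflate N '' BPi.Irr (G ⧸ N)) ∩ BPi.B π G := by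
  have hf := QuotientGroup.mk'_surjective N
  ext ψ
  constructor
  · rintro ⟨χ, hχ, rfl⟩
    exact ⟨⟨χ, hχ.1, rfl⟩, (BPi.comp_mem_B_iff hf).2 hχ⟩
  · rintro ⟨⟨χ, -, rfl⟩, hψ⟩
    exact ⟨χ, (BPi.comp_mem_B_iff hf).1 hψ, rfl⟩
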